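/- **Setting.** Let $d\in\mathbb N$, $T>0$, $S\subseteq\mathbb R^d$. For $\varepsilon>0$ let $P_{\varepsilon}(S):=\{z\in\mathbb C^d:\ |z_i|<\sup_{x\in S}|x_i|+\varepsilon\ \text{for all } i\}$ and let $\mathcal O(S)$ be the set of functions $f:S\to\mathbb C$ that are, for some $\varepsilon>0$, the restriction to $S$ of a holomorphic function on $P_\varepsilon(S)$. For a complex sequence $\mathbf u=(\mathbf u_\alpha)_{\alpha\in\mathbb N_0^d}$ put $h_{\mathbf u}(z):=\sum_\alpha \mathbf u_\alpha z^\alpha/\alpha!$, and let $\mathcal S^*$ be the set of those $\mathbf u$ for which this series converges absolutely on $P_\varepsilon(S)$ for some $\varepsilon>0$. Let $b:S\to\mathbb R^d$ and $a:S\to\mathbb S^d_+$ be measurable and let $K(x,d\xi)$ be a transition kernel from $S$ to $\mathbb R^d$ with $K(x,\{0\})=0$ and $\int\|\xi\|\wedge\|\xi\|^2K(x,d\xi)<\infty$ for all $x\in S$. Let $\mathcal D(\mathcal A)$ be the set of $f\in C^2(\mathbb R^d;\mathbb C)$ with $\int|f(x+\xi)-f(x)-\nabla f(x)^\top\xi|\,K(x,d\xi)<\infty$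 for all $x\in S$, and for $f\in\mathcal D(\mathcal A)$, $x\in S$ put $$\mathcal Af(x)=\nabla f(x)^\top b(x)+\tfrac12\mathrm{Tr}\big(a(x)\nabla^2f(x)\big)+\int f(x+\xi)-f(x)-\nabla f(x)^\top\xi\ K(x,d\xi).$$ Let $X=(X_t)_{t\in[0,T]}$ be an $S$-valued jump-diffusion with characteristics $(b,a,K)$ on a filtered probability space, i.e. a càdlàg special semimartingale with values in $S$ such that for every bounded $f\in C^2(\mathbb R^d;\mathbb C)$ the process $$N^f_t:=f(X_t)-f(X_0)-\int_0^t\mathcal Af(X_s)\,ds,\qquad t\in[0,T],$$ is well defined and a local martingale. Let $\mathcal V\subseteq\mathcal O(S)$ be a linear space and suppose that $X$ is $\mathcal V$-holomorphic: each $f\in\mathcal V$ is the restriction to $S$ of a function in $\mathcal D(\mathcal A)$ (fix one such extension for each $f\in\mathcal V$; $\mathcal Af$ and $N^f$ are formed with it), $\mathcal Af\in\mathcal O(S)$, and $N^f$ is well defined and a local martingale. Put $\mathcal V^*:=\{\mathbf u\in\mathcal S^*:\ h_{\mathbf u}|_S\in\mathcal V\}$ and let $L:\mathcal V^*\to\mathcal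 S^*$ be a linear map with $\mathcal Ah_{\mathbf u}=h_{L(\mathbf u)}|_S$ for all $\mathbf u\in\mathcal V^*$. **Theorem.** Let $X_0=x_0\in S$ almost surely, fix $\mathbf u\in\mathcal V^*$, and suppose that: 1. there is a $\mathcal V^*$-valued map $(\mathbf c(t))_{t\in[0,T]}$ with $\mathbf c(t)=\mathbf u+\int_0^tL(\mathbf c(s))\,ds$ (componentwise) for all $t\in[0,T]$, and $h_{\mathbf c(t)}(x)=h_{\mathbf u}(x)+\int_0^th_{L(\mathbf c(s))}(x)\,ds$ for all $x\in S$, $t\in[0,T]$, all integrands being integrable on $[0,T]$; 2. for each $s\in[0,T]$, the process $(N^{h_{\mathbf c(s)}}_t)_{t\in[0,T]}$ is a true martingale; 3. $\int_0^T\int_0^T\mathbb E\big[|\mathcal Ah_{\mathbf c(s)}(X_t)|\big]\,ds\,dt<\infty$, and, for the initial sequence, $\int_0^T\mathbb E\big[|\mathcal Ah_{\mathbf u}(X_t)|\big]\,dt<\infty$. Then $h_{\mathbf u}(X_T)$ is integrable and $$\mathbb E[h_{\mathbf u}(X_T)]=h_{\mathbf c(T)}(x_0).$$ -/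

import Mathlib

open MeasureTheory ProbabilityTheory Filter Topology
open scoped NNReal ENNReal Nat

namespace HolomorphicJumpDiffusion

/-! ### Sequences indexed by multi-indices and their power series -/

/-- Complex sequences indexed by the multi-indices `α ∈ ℕ₀ᵈ`. -/
abbrev Seq (d : ℕ) : Type := (Fin d → ℕ) → ℂ

/-- The term `u_α z^α / α!`. -/
noncomputable def powTerm {d : ℕ} (u : Seq d) (z : Fin d → ℂ) (α : Fin d → ℕ) : ℂ :=
  u α * (∏ i, z i ^ α i) / ((∏ i, (α i)! : ℕ) : ℂ)

/-- The power series `h_u(z) = ∑_α u_α z^α / α!`. -/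
noncomputable def powSeries {d : ℕ} (u : Seq d) (z : Fin d → ℂ) : ℂ :=
  ∑' α, powTerm u z α

/-- The open polydisc around `0` with polyradius `R ∈ [0,∞]ᵈ`. -/
def polydisc {d : ℕ} (R : Fin d → ℝ≥0∞) : Set (Fin d → ℂ) :=
  {z | ∀ i, ‖z i‖ₑ < R i}

/-- The sequences `u` with `|u|_z = ∑_α |u_α z^α / α!| < ∞` for all `z` in the polydisc. -/
def PStar {d : ℕ} (R : Fin d → ℝ≥0∞) : Set (Seq d) :=
  {u | ∀ z ∈ polydisc R, Summable fun α => ‖powTerm u z α‖}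

/-- `R_i(S) + ε`, where `R_i(S) = sup {|x_i| : x ∈ S} ∈ [0,∞]`. -/
noncomputable def polyradius {d : ℕ} (S : Set (EuclideanSpace ℝ (Fin d))) (ε : ℝ≥0) :
    Fin d → ℝ≥0∞ :=
  fun i => (⨆ x ∈ S, ‖x i‖ₑ) + ε

/-- A point of `ℝᵈ` seen in `ℂᵈ`. -/
def toC {d : ℕ} (x : EuclideanSpace ℝ (Fin d)) : Fin d → ℂ := fun i => (x i : ℂ)

/-- `f ∈ 𝒪(S)`: for some `ε > 0`, `f` is the restriction to `S` of a holomorphic function on the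
polydisc with polyradius `R(S) + ε`. -/
def IsHolo {d : ℕ} {S : Set (EuclideanSpace ℝ (Fin d))} (f : S → ℂ) : Prop :=
  ∃ ε : ℝ≥0, 0 < ε ∧ ∃ h : (Fin d → ℂ) → ℂ,
    DifferentiableOn ℂ h (polydisc (polyradius S ε)) ∧ ∀ x : S, f x = h (toC x)

theorem toC_mem {d : ℕ} {S : Set (EuclideanSpace ℝ (Fin d))} {ε : ℝ≥0} (hε : 0 < ε) (x : S) :
    toC (x : EuclideanSpace ℝ (Fin d)) ∈ polydisc (polyradius S ε) := by
  intro i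
  have h1 : ‖(x : EuclideanSpace ℝ (Fin d)) i‖ₑ ≤ ⨆ y ∈ S, ‖y i‖ₑ :=
    le_iSup₂ (f := fun (y : EuclideanSpace ℝ (Fin d)) (_ : y ∈ S) => ‖y i‖ₑ) x.1 x.2
  have h2 : ‖toC (x : EuclideanSpace ℝ (Fin d)) i‖ₑ = ‖(x : EuclideanSpace ℝ (Fin d)) i‖ₑ := by
    simp [toC, enorm_eq_nnnorm]
  rw [h2]
  refine lt_of_lt_of_le (ENNReal.lt_add_right (by simp) ?_) (add_le_add_left h1 (ε : ℝ≥0∞))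
  simpa using hε.ne'

theorem polydisc_mono {d : ℕ} {S : Set (EuclideanSpace ℝ (Fin d))} {ε δ : ℝ≥0} (h : ε ≤ δ) :
    polydisc (polyradius S ε) ⊆ polydisc (polyradius S δ) := by
  intro z hz i
  refine (hz i).trans_le ?_
  unfold polyradius
  gcongr

theorem powTerm_add {d : ℕ} (u v : Seq d) (z : Fin d → ℂ) (α : Fin d → ℕ) :
    powTerm (u + v) z α = powTerm u z α + powTerm v z α := by
  simp only [powTerm, Pi.add_apply]; ring

theorem powTerm_smul {d : ℕ} (r : ℝ) (u : Seq d) (z : Fin d → ℂ) (α : Fin d → ℕ) :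
    powTerm (r • u) z α = r • powTerm u z α := by
  simp only [powTerm, Pi.smul_apply, Complex.real_smul]; ring

/-- The linear space `𝒮*` of coefficient sequences `u` whose power series converges absolutely on
the polydisc with polyradius `R(S) + ε`, for some `ε > 0`; equivalently, of the Taylor coefficients
of the functions that are holomorphic on such a polydisc. -/
def SStar {d : ℕ} (S : Set (EuclideanSpace ℝ (Fin d))) : Submodule ℝ (Seq d) where
  carrier := {u | ∃ ε : ℝ≥0, 0 < ε ∧ u ∈ PStar (polyradius S ε)}
  zero_mem' := ⟨1, one_pos, fun z _ => by simp [powTerm, summable_zero]⟩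
  add_mem' := by
    rintro u v ⟨ε, hε, hu⟩ ⟨δ, hδ, hv⟩
    refine ⟨min ε δ, lt_min hε hδ, fun z hz => ?_⟩
    have h1 := hu z (polydisc_mono (min_le_left _ _) hz)
    have h2 := hv z (polydisc_mono (min_le_right _ _) hz)
    refine Summable.of_nonneg_of_le (fun _ => norm_nonneg _) (fun α => ?_) (h1.add h2)
    rw [powTerm_add]
    exact norm_add_le _ _
  smul_mem' := by
    rintro r u ⟨ε, hε, hu⟩
    refine ⟨ε, hε, fun z hz => ?_⟩
    refine ((hu z hz).mul_left ‖r‖).congr fun α => ?_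
    rw [powTerm_smul, norm_smul]

/-- The function `x ↦ h_u(x)` on `S`. -/
noncomputable def hS {d : ℕ} {S : Set (EuclideanSpace ℝ (Fin d))} (u : Seq d) : S → ℂ :=
  fun x => powSeries u (toC (x : EuclideanSpace ℝ (Fin d)))

theorem summable_powTerm {d : ℕ} {S : Set (EuclideanSpace ℝ (Fin d))} {u : Seq d}
    (hu : u ∈ SStar S) (x : S) :
    Summable (powTerm u (toC (x : EuclideanSpace ℝ (Fin d)))) := by
  obtain ⟨ε, hε, h⟩ := hu
  exact (h _ (toC_mem hε x)).of_norm

/-- The linear space `𝒱*` of those `u ∈ 𝒮*` for which `h_u` is, on `S`, a function of `𝒱`. -/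
def VStar {d : ℕ} {S : Set (EuclideanSpace ℝ (Fin d))} (V : Submodule ℝ (S → ℂ)) :
    Submodule ℝ (Seq d) where
  carrier := {u | u ∈ SStar S ∧ hS u ∈ V}
  zero_mem' := by
    refine ⟨Submodule.zero_mem _, ?_⟩
    have : (hS (0 : Seq d) : S → ℂ) = 0 := by
      funext x; simp [hS, powSeries, powTerm]
    rw [this]; exact V.zero_mem
  add_mem' := by
    rintro u v ⟨hu, hu'⟩ ⟨hv, hv'⟩
    refine ⟨Submodule.add_mem _ hu hv, ?_⟩
    have : (hS (u + v) : S → ℂ) = hS u + hS v := by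
      funext x
      simp only [hS, powSeries, powTerm_add, Pi.add_apply]
      exact (summable_powTerm hu x).tsum_add (summable_powTerm hv x)
    rw [this]; exact V.add_mem hu' hv'
  smul_mem' := by
    rintro r u ⟨hu, hu'⟩
    refine ⟨Submodule.smul_mem _ r hu, ?_⟩
    have : (hS (r • u) : S → ℂ) = r • hS u := by
      funext x
      simp only [hS, powSeries, powTerm_smul, Pi.smul_apply]
      exact (summable_powTerm hu x).tsum_const_smul r
    rw [this]; exact V.smul_mem r hu'

/-- The element `h_u|_S` of `𝒱` determined by `u ∈ 𝒱*`. -/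
noncomputable def hV {d : ℕ} {S : Set (EuclideanSpace ℝ (Fin d))}
    {V : Submodule ℝ (S → ℂ)} (u : VStar V) : V :=
  ⟨hS (u : Seq d), u.2.2⟩

/-! ### The extended generator -/

/-- Characteristics `(b, a, K)` on the state space `S ⊆ ℝᵈ` (truncation function `χ(ξ) = ξ`). -/
structure Characteristics {d : ℕ} (S : Set (EuclideanSpace ℝ (Fin d))) where
  b : S → EuclideanSpace ℝ (Fin d)
  a : S → Matrix (Fin d) (Fin d) ℝ
  K : Kernel S (EuclideanSpace ℝ (Fin d))
  measurable_b : Measurable b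
  measurable_a : ∀ i j, Measurable fun x => a x i j
  posSemidef_a : ∀ x, (a x).PosSemidef
  K_zero : ∀ x, K x {0} = 0
  K_int : ∀ x, ∫⁻ ξ, ENNReal.ofReal (min ‖ξ‖ (‖ξ‖ ^ 2)) ∂K x < ∞

namespace Characteristics

variable {d : ℕ} {S : Set (EuclideanSpace ℝ (Fin d))}

/-- The integrand `f(x+ξ) - f(x) - ∇f(x)ᵀ ξ` of the jump part. -/
noncomputable def jumpIncr (f : EuclideanSpace ℝ (Fin d) → ℂ)
    (x ξ : EuclideanSpace ℝ (Fin d)) : ℂ :=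
  f (x + ξ) - f x - fderiv ℝ f x ξ

/-- The domain `𝒟(𝒜)`. -/
def dom (χ : Characteristics S) : Set (EuclideanSpace ℝ (Fin d) → ℂ) :=
  {f | ContDiff ℝ 2 f ∧ ∀ x : S, Integrable (fun ξ => jumpIncr f x ξ) (χ.K x)}

/-- The operator `𝒜f(x) = ∇f(x)ᵀ b(x) + ½ Tr(a(x) ∇²f(x)) + ∫ f(x+ξ) - f(x) - ∇f(x)ᵀ ξ K(x,dξ)`. -/
noncomputable def gen (χ : Characteristics S) (f : EuclideanSpace ℝ (Fin d) → ℂ) (x : S) : ℂ :=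
  fderiv ℝ f x (χ.b x)
    + (1 / 2 : ℂ) * ∑ i, ∑ j, (χ.a x i j : ℂ) *
        iteratedFDeriv ℝ 2 f x ![EuclideanSpace.single j 1, EuclideanSpace.single i 1]
    + ∫ ξ, jumpIncr f x ξ ∂χ.K x

end Characteristics

/-! ### Stochastic processes on the time interval `[0,T]` -/

/-- The time interval `[0,T]`, with least element `⊥ = 0` and greatest element `⊤ = T`. -/
abbrev Time (T : ℝ) : Type := Set.Icc (0 : ℝ) T

/-- Lebesgue measure on `[0,T]`. -/
noncomputable def leb (T : ℝ) : Measure (Time T) := Measure.comap Subtype.val volume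

section Processes

variable {T : ℝ} [Fact (0 ≤ T)] {Ω : Type*} {mΩ : MeasurableSpace Ω}

/-- Right-continuous paths with left limits. -/
def IsCadlag {E : Type*} [TopologicalSpace E] (p : Time T → E) : Prop :=
  ∀ t, ContinuousWithinAt p (Set.Ici t) t ∧ ∃ l, Tendsto p (𝓝[<] t) (𝓝 l)

/-- Local martingales on `[0,T]`. A localizing sequence on `[0,T]` consists of stopping times with
values in `[0,T] ∪ {⊤}` that are almost surely eventually equal to `⊤`. -/
def IsLocalMartingale {E : Type*} [NormedAddCommGroup E] [NormedSpace ℝ E] [CompleteSpace E]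
    (ℱ : Filtration (Time T) mΩ) (P : Measure Ω) (N : Time T → Ω → E) : Prop :=
  StronglyAdapted ℱ N ∧ (∀ᵐ ω ∂P, IsCadlag fun t => N t ω) ∧
    Locally (fun Y => Martingale Y ℱ P) ℱ N P

/-- Real-valued special semimartingales: `Y = Y₀ + M + A` with a local martingale `M` and a
predictable càdlàg process `A` of finite variation, both started at `0`. -/
def IsSpecialSemimartingale (ℱ : Filtration (Time T) mΩ) (P : Measure Ω)
    (Y : Time T → Ω → ℝ) : Prop :=
  ∃ M A : Time T → Ω → ℝ,
    IsLocalMartingale ℱ P M ∧ (∀ᵐ ω ∂P, M ⊥ ω = 0) ∧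
    IsStronglyPredictable ℱ A ∧
    (∀ᵐ ω ∂P, A ⊥ ω = 0 ∧ IsCadlag (fun t => A t ω) ∧
      BoundedVariationOn (fun t => A t ω) Set.univ) ∧
    ∀ᵐ ω ∂P, ∀ t, Y t ω = Y ⊥ ω + M t ω + A t ω

variable {d : ℕ} {S : Set (EuclideanSpace ℝ (Fin d))}

/-- The process `N^f_t = f(X_t) - f(X_0) - ∫_0^t 𝒜f(X_s) ds`. -/
noncomputable def procN (χ : Characteristics S) (X : Time T → Ω → S)
    (f : EuclideanSpace ℝ (Fin d) → ℂ) (t : Time T) (ω : Ω) : ℂ :=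
  f (X t ω) - f (X ⊥ ω) - ∫ s in Set.Iic t, χ.gen f (X s ω) ∂leb T

/-- `N^f` is well defined (its time integral exists) and is a local martingale. -/
def NIsLocalMartingale (χ : Characteristics S) (ℱ : Filtration (Time T) mΩ) (P : Measure Ω)
    (X : Time T → Ω → S) (f : EuclideanSpace ℝ (Fin d) → ℂ) : Prop :=
  (∀ᵐ ω ∂P, Integrable (fun s : Time T => χ.gen f (X s ω)) (leb T)) ∧
    IsLocalMartingale ℱ P (procN χ X f)

/-- `X` is an `S`-valued jump-diffusion with characteristics `χ = (b, a, K)`. -/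
structure IsJumpDiffusion (χ : Characteristics S) (ℱ : Filtration (Time T) mΩ) (P : Measure Ω)
    (X : Time T → Ω → S) : Prop where
  adapted : ∀ t, Measurable[ℱ t] (X t)
  cadlag : ∀ ω, IsCadlag fun t => (X t ω : EuclideanSpace ℝ (Fin d))
  special : ∀ i, IsSpecialSemimartingale ℱ P
    fun t ω => (X t ω : EuclideanSpace ℝ (Fin d)) i
  localMartingale : ∀ f : EuclideanSpace ℝ (Fin d) → ℂ, ContDiff ℝ 2 f →
    (∃ C : ℝ, ∀ x, ‖f x‖ ≤ C) → NIsLocalMartingale χ ℱ P X f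

/-- `X` is an `S`-valued `𝒱`-holomorphic process, for a linear space `𝒱 ⊆ 𝒪(S)` of functions on
`S`. The functions of `𝒱` belong to `𝒟(𝒜)` in the sense that they are restrictions to `S` of
functions of `𝒟(𝒜)`, which are defined on all of `ℝᵈ`; `ext` is the choice of these
extensions through which `𝒜` acts on `𝒱`. -/
structure IsHolomorphicProcess (χ : Characteristics S) (ℱ : Filtration (Time T) mΩ)
    (P : Measure Ω) (X : Time T → Ω → S) (V : Submodule ℝ (S → ℂ))
    (ext : V → EuclideanSpace ℝ (Fin d) → ℂ) : Prop where
  jumpDiffusion : IsJumpDiffusion χ ℱ P X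
  holo : ∀ f : V, IsHolo (f : S → ℂ)
  ext_mem_dom : ∀ f : V, ext f ∈ χ.dom
  ext_eq : ∀ (f : V) (x : S), ext f x = (f : S → ℂ) x
  gen_holo : ∀ f : V, IsHolo (χ.gen (ext f))
  localMartingale : ∀ f : V, NIsLocalMartingale χ ℱ P X (ext f)

end Processes

end HolomorphicJumpDiffusion

open HolomorphicJumpDiffusion

/-!
The proof is a duality argument. Write `H(s, x) = h_{L(c(s))}(x) = 𝒜h_{c(s)}(x)` and consider
`f(s, t) = E[h_{c(s)}(X_t)]` on `[0,T]²`, together with `ρ(s, t) = E[H(s, X_t)]`. For almost every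
`s`, and for `s = 0`, the martingale property of `N^{h_{c(s)}}` gives Dynkin's formula
`f(s, t) = f(s, 0) + ∫_0^t ρ(s, r) dr` (`integral_eq_add_integral_gen`). For almost every `t`, the
coefficient equation and Fubini's theorem give `f(s, t) = f(0, t) + ∫_0^s ρ(r, t) dr`. So both
partial derivatives of `f` are `ρ`, and `f` should be constant on the antidiagonals `s + t = τ`;
the values at `(T, 0)` and `(0, T)` are the two sides of the claim.

As the two formulas hold almost everywhere only, they are compared through their integrals over the
triangles `{s + t ≤ τ}`. There the terms with `ρ` both become `∫∫ (τ - s - t)⁺ ρ(s, t)`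
(`setIntegral_triangle_setIntegral_Iic`) and cancel. What is left says that the second primitive of
`f(·, 0) - f(0, ·)` vanishes; both functions are continuous, hence they agree everywhere on `[0,T]`
(`eq_of_primitives_eq`).

For the use of Fubini's theorem, `X` is jointly measurable because its paths are right-continuous
(`measurable_uncurry_of_rightContinuous`), and `H` has a jointly measurable version because the
coefficients `L(c(s))_α` are measurable in `s` up to null sets (`exists_measurable_hS`).
-/

namespace HolomorphicJumpDiffusion

/-! ### Integration over the time interval -/

section TimeIntegrals

variable {T : ℝ} {E : Type*} [NormedAddCommGroup E] [NormedSpace ℝ E]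

instance : IsFiniteMeasure (leb T) := by
  refine ⟨?_⟩
  rw [leb, comap_subtype_coe_apply measurableSet_Icc, Set.image_univ, Subtype.range_coe]
  exact measure_Icc_lt_top

theorem leb_setOf_le_and_add_le {r s τ : ℝ} (hr : 0 ≤ r) (hs : 0 ≤ s) (hτ : τ ≤ T) :
    (leb T).real {x : Time T | r ≤ x ∧ s + x ≤ τ} = max (τ - s - r) 0 := by
  have h : Subtype.val '' {x : Time T | r ≤ x ∧ s + x ≤ τ} = Set.Icc r (τ - s) := by
    ext y
    simp only [Set.mem_image, Set.mem_ofPred_eq, Subtype.exists, Set.mem_Icc]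
    constructor
    · rintro ⟨y, _, h, rfl⟩
      exact ⟨h.1, by linarith⟩
    · rintro ⟨h1, h2⟩
      exact ⟨y, ⟨by linarith, by linarith⟩, ⟨h1, by linarith⟩, rfl⟩
  rw [measureReal_def, leb, comap_subtype_coe_apply measurableSet_Icc, h, Real.volume_Icc,
    ENNReal.toReal_ofReal']

theorem leb_singleton (t : Time T) : leb T {t} = 0 := by
  rw [leb, comap_subtype_coe_apply measurableSet_Icc]
  simp

/-- Both sides integrate `g(r)` over `{(r, x) : r ≤ x, s + x ≤ τ}`. -/
theorem setIntegral_setIntegral_Iic_leb [CompleteSpace E] {g : Time T → E}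
    (hg : Integrable g (leb T)) {s τ : ℝ} (hs : 0 ≤ s) (hτ : τ ≤ T) :
    ∫ x in {x : Time T | s + x ≤ τ}, (∫ r in Set.Iic x, g r ∂leb T) ∂leb T =
      ∫ r, (max (τ - s - r) 0) • g r ∂leb T := by
  have hm : MeasurableSet {x : Time T | s + x ≤ τ} :=
    measurableSet_le (by fun_prop) (by fun_prop)
  have hm2 : MeasurableSet {p : Time T × Time T | (p.2 : ℝ) ≤ p.1 ∧ s + p.1 ≤ τ} := by
    measurability
  calc
    _ = ∫ x, ∫ r, {p : Time T × Time T | (p.2 : ℝ) ≤ p.1 ∧ s + p.1 ≤ τ}.indicator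
          (fun p => g p.2) (x, r) ∂leb T ∂leb T := by
        rw [← integral_indicator hm]
        refine integral_congr_ae (Eventually.of_forall fun x => ?_)
        by_cases hx : s + (x : ℝ) ≤ τ
        · simp only [Set.indicator_apply, Set.mem_ofPred_eq, hx, if_true, and_true]
          rw [← integral_indicator measurableSet_Iic]
          simp [Set.indicator_apply]
        · simp [hx]
    _ = ∫ r, ∫ x, {p : Time T × Time T | (p.2 : ℝ) ≤ p.1 ∧ s + p.1 ≤ τ}.indicator
          (fun p => g p.2) (x, r) ∂leb T ∂leb T := by
        refine integral_integral_swap (f := fun x r =>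
          {p : Time T × Time T | (p.2 : ℝ) ≤ p.1 ∧ s + p.1 ≤ τ}.indicator
            (fun p => g p.2) (x, r)) ?_
        exact (hg.comp_snd (leb T)).indicator hm2
    _ = _ := by
        refine integral_congr_ae (Eventually.of_forall fun r => ?_)
        have : MeasurableSet {x : Time T | (r : ℝ) ≤ x ∧ s + x ≤ τ} := by
          measurability
        calc
          _ = ∫ x, {x : Time T | (r : ℝ) ≤ x ∧ s + x ≤ τ}.indicator (fun _ => g r) x ∂leb T := by
            simp [Set.indicator_apply]
          _ = _ := by
            rw [integral_indicator_const _ this, leb_setOf_le_and_add_le r.2.1 hs hτ]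

variable [hT : Fact (0 ≤ T)]

theorem setIntegral_Iic_leb (f : Time T → E) (t : Time T) :
    ∫ s in Set.Iic t, f s ∂leb T = ∫ s in (0 : ℝ)..t, f (Set.projIcc 0 T hT.out s) := by
  have h : ∀ s : Time T, (Set.Iic t).indicator f s =
      (Set.Iic (t : ℝ)).indicator (fun s => f (Set.projIcc 0 T hT.out s)) (s : ℝ) := by
    intro s
    simp [Set.indicator_apply]
  have hI : Set.Icc 0 T ∩ Set.Iic (t : ℝ) = Set.Icc 0 (t : ℝ) := by
    ext y
    simp only [Set.mem_inter_iff, Set.mem_Icc, Set.mem_Iic]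
    exact ⟨fun h => ⟨h.1.1, h.2⟩, fun h => ⟨⟨h.1, h.2.trans t.2.2⟩, h.2⟩⟩
  rw [← integral_indicator measurableSet_Iic, integral_congr_ae (Eventually.of_forall h), leb,
    integral_subtype_comap measurableSet_Icc, setIntegral_indicator measurableSet_Iic, hI,
    integral_Icc_eq_integral_Ioc, intervalIntegral.integral_of_le t.2.1]

theorem continuous_setIntegral_Iic_leb {f : Time T → E} (hf : Integrable f (leb T)) :
    Continuous fun t => ∫ s in Set.Iic t, f s ∂leb T := by
  have h : IntegrableOn (fun s => f (Set.projIcc 0 T hT.out s)) (Set.Icc 0 T) volume := by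
    rw [integrableOn_iff_comap_subtypeVal measurableSet_Icc]
    refine hf.congr (Eventually.of_forall fun s => ?_)
    simp
  have h2 := intervalIntegral.continuousOn_primitive h
  rw [continuousOn_iff_continuous_domRestrict] at h2
  convert h2 using 2 with t
  rw [setIntegral_Iic_leb, intervalIntegral.integral_of_le t.2.1]
  rfl

/-- The hypothesis `0 < T` cannot be dropped: `leb 0 = 0` on the one-point interval `[0,0]`. -/
theorem eq_zero_of_forall_setIntegral_Iic_leb [CompleteSpace E] (hT0 : 0 < T) {f : Time T → E}
    (hf : Continuous f) (h : ∀ t, ∫ s in Set.Iic t, f s ∂leb T = 0) : f = 0 := by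
  set g : ℝ → E := fun s => f (Set.projIcc 0 T hT.out s) with hg
  have hgc : Continuous g := hf.comp continuous_projIcc
  have h0 : ∀ x ∈ Set.Ioo 0 T, g x = 0 := by
    intro x hx
    have hd : HasDerivAt (fun u => ∫ s in (0 : ℝ)..u, g s) (g x) x :=
      (hgc.integral_hasStrictDerivAt 0 x).hasDerivAt
    refine hd.unique ((hasDerivAt_const x (0 : E)).congr_of_eventuallyEq ?_)
    filter_upwards [Ioo_mem_nhds hx.1 hx.2] with y hy
    simpa [setIntegral_Iic_leb] using h ⟨y, hy.1.le, hy.2.le⟩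
  have h1 : Set.EqOn g 0 (closure (Set.Ioo 0 T)) :=
    Set.EqOn.closure h0 hgc continuous_const
  rw [closure_Ioo hT0.ne] at h1
  funext t
  simpa [hg] using h1 t.2

end TimeIntegrals

/-! ### A function on the square that is absolutely continuous in each variable -/

section Triangle

variable {T : ℝ} {E : Type*} [NormedAddCommGroup E] [NormedSpace ℝ E]

theorem integrable_setIntegral_Iic_snd {ρ : Time T → Time T → E}
    (hm : StronglyMeasurable (Function.uncurry ρ))
    (hi : Integrable (Function.uncurry ρ) ((leb T).prod (leb T))) :
    Integrable (fun p : Time T × Time T => ∫ r in Set.Iic p.2, ρ p.1 r ∂leb T)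
      ((leb T).prod (leb T)) := by
  have hS : MeasurableSet {q : (Time T × Time T) × Time T | q.2 ≤ q.1.2} :=
    measurableSet_le (by fun_prop) (by fun_prop)
  have h1 : StronglyMeasurable fun p : Time T × Time T =>
      ∫ r in Set.Iic p.2, ρ p.1 r ∂leb T := by
    have h2 : StronglyMeasurable fun q : (Time T × Time T) × Time T =>
        {q : (Time T × Time T) × Time T | q.2 ≤ q.1.2}.indicator (fun q => ρ q.1.1 q.2) q := by
      refine StronglyMeasurable.indicator ?_ hS
      exact hm.comp_measurable (by fun_prop : Measurable
        fun q : (Time T × Time T) × Time T => (q.1.1, q.2))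
    convert h2.integral_prod_right' (ν := leb T) using 2 with p
    rw [← integral_indicator measurableSet_Iic]
    simp [Set.indicator_apply]
  refine Integrable.mono' (hi.norm.integral_prod_left.comp_fst (leb T)) h1.aestronglyMeasurable ?_
  have h3 : ∀ᵐ p ∂(leb T).prod (leb T), Integrable (fun r => ρ p.1 r) (leb T) :=
    Measure.quasiMeasurePreserving_fst.ae hi.prod_right_ae
  filter_upwards [h3] with p hp
  refine (norm_integral_le_integral_norm _).trans ?_
  exact setIntegral_le_integral hp.norm (Eventually.of_forall fun _ => norm_nonneg _)

/-- The integral over the triangle `{s + t ≤ τ}` of the primitive of `ρ` in its second variable.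
The weight on the right is symmetric in the two variables, so that the primitive of `ρ` in the
first variable has the same integral. -/
theorem setIntegral_triangle_setIntegral_Iic [CompleteSpace E] {ρ : Time T → Time T → E}
    (hm : StronglyMeasurable (Function.uncurry ρ))
    (hi : Integrable (Function.uncurry ρ) ((leb T).prod (leb T))) {τ : ℝ} (hτ : τ ≤ T) :
    ∫ p in {p : Time T × Time T | (p.1 : ℝ) + p.2 ≤ τ},
        (∫ r in Set.Iic p.2, ρ p.1 r ∂leb T) ∂(leb T).prod (leb T) =
      ∫ p : Time T × Time T, (max (τ - p.1 - p.2) 0) • ρ p.1 p.2 ∂(leb T).prod (leb T) := by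
  have hR : MeasurableSet {p : Time T × Time T | (p.1 : ℝ) + p.2 ≤ τ} :=
    measurableSet_le (by fun_prop) (by fun_prop)
  have hw : Integrable (fun p : Time T × Time T => (max (τ - p.1 - p.2) 0) • ρ p.1 p.2)
      ((leb T).prod (leb T)) := by
    refine hi.bdd_smul |τ|
      (by fun_prop : Measurable fun p : Time T × Time T =>
        max (τ - p.1 - p.2) 0).aestronglyMeasurable
      (Eventually.of_forall fun p => ?_)
    have h1 := p.1.2.1
    have h2 := p.2.2.1
    rw [Real.norm_eq_abs, abs_of_nonneg (le_max_right _ _)]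
    exact max_le (by linarith [le_abs_self τ]) (abs_nonneg _)
  rw [← integral_indicator hR,
    integral_prod _ ((integrable_setIntegral_Iic_snd hm hi).indicator hR), integral_prod _ hw]
  refine integral_congr_ae ?_
  filter_upwards [hi.prod_right_ae] with s hs
  simp only [Function.uncurry_apply_pair] at hs
  rw [← setIntegral_setIntegral_Iic_leb hs s.2.1 hτ, ← integral_indicator
    (measurableSet_le (by fun_prop) (by fun_prop))]
  rfl

/-- If a function on `[0,T]²` has the density `ρ` both as a primitive in its second variable with
initial value `A` and as a primitive in its first variable with initial value `B`, then `A = B`. -/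
theorem eq_of_primitives_eq [Fact (0 ≤ T)] [CompleteSpace E] (hT0 : 0 < T)
    {ρ : Time T → Time T → E}
    (hm : StronglyMeasurable (Function.uncurry ρ))
    (hi : Integrable (Function.uncurry ρ) ((leb T).prod (leb T))) {A B : Time T → E}
    (hA : Continuous A) (hB : Continuous B)
    (h : ∀ᵐ p : Time T × Time T ∂(leb T).prod (leb T),
      A p.1 + ∫ r in Set.Iic p.2, ρ p.1 r ∂leb T =
        B p.2 + ∫ r in Set.Iic p.1, ρ r p.2 ∂leb T) : A = B := by
  have hint : ∀ {f : Time T → E}, Continuous f → Integrable f (leb T) := fun hf =>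
    integrableOn_univ.1 (hf.continuousOn.integrableOn_compact isCompact_univ)
  have hρs : StronglyMeasurable (Function.uncurry fun s t => ρ t s) :=
    hm.comp_measurable measurable_swap
  have his : Integrable (Function.uncurry fun s t => ρ t s) ((leb T).prod (leb T)) := hi.swap
  have hI := integrable_setIntegral_Iic_snd hm hi
  have hJ : Integrable (fun p : Time T × Time T => ∫ r in Set.Iic p.1, ρ r p.2 ∂leb T)
      ((leb T).prod (leb T)) := (integrable_setIntegral_Iic_snd hρs his).swap
  have hD : Continuous fun t => A t - B t := hA.sub hB
  have hDi := hint hD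
  -- the triangle and the product measure are invariant under the exchange of the two variables
  have hswap : ∀ (f : Time T × Time T → E) (τ : ℝ),
      ∫ p in {p : Time T × Time T | (p.1 : ℝ) + p.2 ≤ τ}, f p.swap ∂(leb T).prod (leb T) =
        ∫ p in {p : Time T × Time T | (p.1 : ℝ) + p.2 ≤ τ}, f p ∂(leb T).prod (leb T) := by
    intro f τ
    have hR : MeasurableSet {p : Time T × Time T | (p.1 : ℝ) + p.2 ≤ τ} :=
      measurableSet_le (by fun_prop) (by fun_prop)
    rw [← integral_indicator hR, ← integral_indicator hR, ← integral_prod_swap]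
    refine integral_congr_ae (Eventually.of_forall fun p => ?_)
    simp [Set.indicator_apply, add_comm]
  -- the second primitive of `A - B`, as an integral over the triangle
  have key : ∀ τ : Time T, ∫ t in Set.Iic τ, (∫ r in Set.Iic t, (A r - B r) ∂leb T) ∂leb T = 0 := by
    intro τ
    have hR : MeasurableSet {p : Time T × Time T | (p.1 : ℝ) + p.2 ≤ τ} :=
      measurableSet_le (by fun_prop) (by fun_prop)
    have e1 := setIntegral_triangle_setIntegral_Iic hm hi τ.2.2
    have e2 : ∫ p in {p : Time T × Time T | (p.1 : ℝ) + p.2 ≤ τ},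
        (∫ r in Set.Iic p.1, ρ r p.2 ∂leb T) ∂(leb T).prod (leb T) =
        ∫ p : Time T × Time T, (max ((τ : ℝ) - p.1 - p.2) 0) • ρ p.1 p.2
          ∂(leb T).prod (leb T) := by
      rw [← hswap]
      simp only [Prod.fst_swap, Prod.snd_swap]
      rw [setIntegral_triangle_setIntegral_Iic hρs his τ.2.2, ← integral_prod_swap]
      refine integral_congr_ae (Eventually.of_forall fun p => ?_)
      simp only [Prod.fst_swap, Prod.snd_swap]
      rw [sub_right_comm]
    have e3 : ∫ p in {p : Time T × Time T | (p.1 : ℝ) + p.2 ≤ τ}, (A p.1 - B p.2)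
        ∂(leb T).prod (leb T) = 0 := by
      calc
        _ = ∫ p in {p : Time T × Time T | (p.1 : ℝ) + p.2 ≤ τ},
            ((∫ r in Set.Iic p.1, ρ r p.2 ∂leb T) - ∫ r in Set.Iic p.2, ρ p.1 r ∂leb T)
            ∂(leb T).prod (leb T) := by
          refine integral_congr_ae (ae_restrict_of_ae ?_)
          filter_upwards [h] with p hp
          rw [sub_eq_sub_iff_add_eq_add, hp, add_comm]
        _ = 0 := by
          rw [integral_sub hJ.integrableOn hI.integrableOn, e1, e2, sub_self]
    have e4 : ∫ p in {p : Time T × Time T | (p.1 : ℝ) + p.2 ≤ τ}, (A p.1 - B p.1)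
        ∂(leb T).prod (leb T) = 0 := by
      have hAi := ((hint hA).comp_fst (leb T)).integrableOn
        (s := {p : Time T × Time T | (p.1 : ℝ) + p.2 ≤ τ})
      have hBi := ((hint hB).comp_fst (leb T)).integrableOn
        (s := {p : Time T × Time T | (p.1 : ℝ) + p.2 ≤ τ})
      have hBi' := ((hint hB).comp_snd (leb T)).integrableOn
        (s := {p : Time T × Time T | (p.1 : ℝ) + p.2 ≤ τ})
      rw [integral_sub hAi hBi, ← e3, integral_sub hAi hBi', ← hswap fun p => B p.1]
      rfl
    have e5 := setIntegral_setIntegral_Iic_leb hDi le_rfl τ.2.2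
    simp only [zero_add] at e5
    refine (e5.trans ?_).trans e4
    rw [← integral_indicator hR, integral_prod _ ((hDi.comp_fst (leb T)).indicator hR)]
    refine integral_congr_ae (Eventually.of_forall fun s => ?_)
    have hms : MeasurableSet {x : Time T | (0 : ℝ) ≤ x ∧ (s : ℝ) + x ≤ τ} := by
      measurability
    -- the condition `0 ≤ x` is automatic, and brings the slice of the triangle into the form of
    -- `leb_setOf_le_and_add_le`
    have e6 : ∀ x : Time T, {p : Time T × Time T | (p.1 : ℝ) + p.2 ≤ τ}.indicator
        (fun p => A p.1 - B p.1) (s, x) =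
        {x : Time T | (0 : ℝ) ≤ x ∧ (s : ℝ) + x ≤ τ}.indicator (fun _ => A s - B s) x := by
      intro x
      simp [Set.indicator_apply, x.2.1]
    simp only [e6]
    rw [integral_indicator_const _ hms, leb_setOf_le_and_add_le le_rfl s.2.1 τ.2.2]
    simp
  have h1 := eq_zero_of_forall_setIntegral_Iic_leb hT0 (continuous_setIntegral_Iic_leb hDi) key
  have h2 := eq_zero_of_forall_setIntegral_Iic_leb hT0 hD (congrFun h1)
  funext t
  exact sub_eq_zero.1 (congrFun h2 t)

end Triangle

/-! ### Measurability -/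

section Measurability

/-- A right-continuous process is jointly measurable: it is the limit of its values at the right
endpoints of the cells of a grid of mesh `1 / (n + 1)`, cut off at `T`. -/
theorem measurable_uncurry_of_rightContinuous {T : ℝ} [hT : Fact (0 ≤ T)] {Ω E : Type*}
    [MeasurableSpace Ω] [TopologicalSpace E] [TopologicalSpace.PseudoMetrizableSpace E]
    [MeasurableSpace E] [BorelSpace E] {Y : Time T → Ω → E} (hY : ∀ t, Measurable (Y t))
    (hc : ∀ ω t, ContinuousWithinAt (fun t => Y t ω) (Set.Ici t) t) :
    Measurable (Function.uncurry Y) := by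
  set a : ℕ → Time T → ℝ := fun n t => (⌊((n : ℝ) + 1) * t⌋₊ + 1 : ℝ) / (n + 1) with ha
  have ha1 : ∀ (n : ℕ) (t : Time T), (t : ℝ) ≤ a n t := by
    intro n t
    rw [ha, le_div_iff₀ (by positivity), mul_comm]
    exact (Nat.lt_floor_add_one _).le
  have ha2 : ∀ (n : ℕ) (t : Time T), a n t ≤ t + 1 / ((n : ℝ) + 1) := by
    intro n t
    have hn : (0 : ℝ) < n + 1 := by positivity
    have := Nat.floor_le (mul_nonneg hn.le t.2.1)
    have h1 : ((t : ℝ) + 1 / ((n : ℝ) + 1)) * (n + 1) = (n + 1) * t + 1 := by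
      field_simp
    rw [ha, div_le_iff₀ hn, h1]
    linarith
  have hlim : ∀ t, Tendsto (fun n => a n t) atTop (𝓝 (t : ℝ)) := by
    intro t
    refine tendsto_of_tendsto_of_tendsto_of_le_of_le tendsto_const_nhds ?_ (fun n => ha1 n t)
      (fun n => ha2 n t)
    simpa using tendsto_const_nhds.add (tendsto_one_div_add_atTop_nhds_zero_nat (𝕜 := ℝ))
  obtain ⟨grid, hgrid⟩ : ∃ grid : ℕ → ℕ → Time T, ∀ n (t : Time T),
      grid n ⌊((n : ℝ) + 1) * t⌋₊ = Set.projIcc 0 T hT.out (a n t) :=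
    ⟨fun n k => Set.projIcc 0 T hT.out ((k + 1 : ℝ) / (n + 1)), fun n t => rfl⟩
  refine measurable_of_tendsto_metrizable
    (f := fun n p => Y (grid n ⌊((n : ℝ) + 1) * (p.1 : ℝ)⌋₊) p.2) (fun n => ?_) ?_
  · have h1 : Measurable fun p : ℕ × Ω => Y (grid n p.1) p.2 :=
      measurable_from_prod_countable_right fun k => hY (grid n k)
    have h2 : Measurable fun p : Time T × Ω => (⌊((n : ℝ) + 1) * (p.1 : ℝ)⌋₊, p.2) := by
      refine Measurable.prodMk ?_ measurable_snd
      exact Nat.measurable_floor.comp (by fun_prop)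
    exact h1.comp h2
  · rw [tendsto_pi_nhds]
    rintro ⟨t, ω⟩
    simp only [hgrid]
    refine (hc ω t).tendsto.comp (tendsto_nhdsWithin_iff.2 ⟨?_, Eventually.of_forall fun n => ?_⟩)
    · have := (continuous_projIcc (h := hT.out)).continuousAt.tendsto.comp (hlim t)
      simpa [Function.comp_def] using this
    · have := Set.monotone_projIcc hT.out (ha1 n t)
      simpa using this

theorem setIntegral_Iic_leb_bot {T : ℝ} [Fact (0 ≤ T)] {E : Type*} [NormedAddCommGroup E]
    [NormedSpace ℝ E] (f : Time T → E) : ∫ s in Set.Iic ⊥, f s ∂leb T = 0 := by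
  have h0 : (leb T).restrict (Set.Iic ⊥) = 0 := by
    rw [Set.Iic_bot, Measure.restrict_eq_zero, leb_singleton]
  rw [h0, integral_zero_measure]

theorem measurable_hS_apply {A : Type*} [MeasurableSpace A] {d : ℕ}
    {S : Set (EuclideanSpace ℝ (Fin d))} {v : A → Seq d} (hv : ∀ α, Measurable fun a => v a α)
    {x : A → S} (hx : Measurable x) : Measurable fun a => hS (v a) (x a) := by
  unfold hS powSeries
  refine Measurable.tsum fun α => ?_
  unfold powTerm toC
  have := hv α
  fun_prop

/-- A family of power series with coefficients that depend measurably on a parameter, up to null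
sets, has a jointly measurable version. -/
theorem exists_measurable_hS {A : Type*} [MeasurableSpace A] {μ : Measure A} {d : ℕ}
    (S : Set (EuclideanSpace ℝ (Fin d))) {v : A → Seq d}
    (hv : ∀ α, AEStronglyMeasurable (fun s => v s α) μ) :
    ∃ H : A → S → ℂ, Measurable (Function.uncurry H) ∧ ∀ᵐ s ∂μ, hS (v s) = H s := by
  refine ⟨fun s => hS fun α => (hv α).mk _ s,
    measurable_hS_apply (fun α =>
      (hv α).stronglyMeasurable_mk.measurable.comp measurable_fst) measurable_snd, ?_⟩
  filter_upwards [ae_all_iff.2 fun α => (hv α).ae_eq_mk] with s hs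
  exact congrArg hS (funext hs)

theorem ae_integrable_prod_of_lintegral {A B Ω : Type*} [MeasurableSpace A] [MeasurableSpace B]
    [MeasurableSpace Ω] {μ : Measure A} {ν : Measure B} {P : Measure Ω} [SFinite ν] [SFinite P]
    {F : A → B → Ω → ℂ} (hF : Measurable fun q : A × B × Ω => F q.1 q.2.1 q.2.2)
    (hfin : ∫⁻ a, ∫⁻ b, ∫⁻ ω, ‖F a b ω‖ₑ ∂P ∂ν ∂μ < ∞) :
    ∀ᵐ a ∂μ, Integrable (fun q : B × Ω => F a q.1 q.2) (ν.prod P) := by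
  have h1 : ∀ a, Measurable fun q : B × Ω => F a q.1 q.2 := fun a =>
    hF.comp measurable_prodMk_left
  have h2 : ∀ a, ∫⁻ q : B × Ω, ‖F a q.1 q.2‖ₑ ∂ν.prod P = ∫⁻ b, ∫⁻ ω, ‖F a b ω‖ₑ ∂P ∂ν :=
    fun a => lintegral_prod _ (h1 a).enorm.aemeasurable
  simp only [← h2] at hfin
  have h3 : Measurable fun a => ∫⁻ q : B × Ω, ‖F a q.1 q.2‖ₑ ∂ν.prod P :=
    hF.enorm.lintegral_prod_right'
  filter_upwards [ae_lt_top h3 hfin.ne] with a ha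
  exact ⟨(h1 a).aestronglyMeasurable, ha⟩

theorem integral_setIntegral_Iic_swap {T : ℝ} {Ω : Type*} [MeasurableSpace Ω] {P : Measure Ω}
    [SFinite P] {F : Time T → Ω → ℂ}
    (hF : Integrable (fun q : Time T × Ω => F q.1 q.2) ((leb T).prod P)) (t : Time T) :
    Integrable (fun ω => ∫ s in Set.Iic t, F s ω ∂leb T) P ∧
      ∫ ω, ∫ s in Set.Iic t, F s ω ∂leb T ∂P = ∫ s in Set.Iic t, ∫ ω, F s ω ∂P ∂leb T := by
  have h : Integrable (fun q : Ω × Time T => F q.2 q.1)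
      (P.prod ((leb T).restrict (Set.Iic t))) := by
    refine hF.swap.mono_measure ?_
    rw [← Measure.restrict_univ (μ := P), Measure.prod_restrict, Measure.restrict_univ]
    exact Measure.restrict_le_self
  exact ⟨h.integral_prod_left, integral_integral_swap (f := fun ω s => F s ω) h⟩

end Measurability

/-! ### Duality of expectations and the coefficient equation -/

section Duality

variable {d : ℕ} {T : ℝ} [Fact (0 ≤ T)] {Ω : Type*} {mΩ : MeasurableSpace Ω} {P : Measure Ω}
  [IsProbabilityMeasure P] {ℱ : Filtration (Time T) mΩ} {S : Set (EuclideanSpace ℝ (Fin d))}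
  {χ : Characteristics S} {X : Time T → Ω → S}

/-- Dynkin's formula: `E[f(X_t)] = f(x₀) + ∫_0^t E[𝒜f(X_s)] ds` when `N^f` is a true martingale. -/
theorem integral_eq_add_integral_gen {f : EuclideanSpace ℝ (Fin d) → ℂ}
    (hmart : Martingale (procN χ X f) ℱ P) {x₀ : S} (hx₀ : ∀ᵐ ω ∂P, X ⊥ ω = x₀)
    (hi : Integrable (fun q : Time T × Ω => χ.gen f (X q.1 q.2)) ((leb T).prod P)) (t : Time T) :
    Integrable (fun ω => f (X t ω)) P ∧
      ∫ ω, f (X t ω) ∂P = f x₀ + ∫ s in Set.Iic t, ∫ ω, χ.gen f (X s ω) ∂P ∂leb T := by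
  obtain ⟨hI, hswap⟩ := integral_setIntegral_Iic_swap (F := fun s ω => χ.gen f (X s ω)) hi t
  have hbot : procN χ X f ⊥ = 0 := by
    funext ω
    simp only [procN, setIntegral_Iic_leb_bot, sub_self, Pi.zero_apply]
  have hN0 : ∫ ω, procN χ X f t ω ∂P = 0 := by
    have := hmart.setIntegral_eq (bot_le : ⊥ ≤ t) (s := Set.univ) MeasurableSet.univ
    simpa [hbot] using this.symm
  have heq : ∀ᵐ ω ∂P, f (X t ω) =
      procN χ X f t ω + (f x₀ + ∫ s in Set.Iic t, χ.gen f (X s ω) ∂leb T) := by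
    filter_upwards [hx₀] with ω hω
    simp only [procN, hω]
    ring
  have hc : Integrable (fun _ : Ω => f x₀) P := integrable_const _
  refine ⟨((hmart.integrable t).add (hc.add hI)).congr (heq.mono fun ω h => h.symm), ?_⟩
  rw [integral_congr_ae heq, integral_add (hmart.integrable t) (by exact hc.add hI), hN0, zero_add,
    integral_add hc hI, integral_const, probReal_univ, one_smul, hswap]

end Duality

end HolomorphicJumpDiffusion

theorem theorem3p17 {d : ℕ} {T : ℝ} [Fact (0 ≤ T)]
    {Ω : Type*} {mΩ : MeasurableSpace Ω} (P : Measure Ω) [IsProbabilityMeasure P]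
    (ℱ : Filtration (Time T) mΩ)
    (S : Set (EuclideanSpace ℝ (Fin d)))
    (χ : Characteristics S)
    (X : Time T → Ω → S)
    -- `𝒱 ⊆ 𝒪(S)`, the choice of representatives in `𝒟(𝒜)`, and the `𝒱`-holomorphic process `X`
    (V : Submodule ℝ (S → ℂ))
    (ext : V → EuclideanSpace ℝ (Fin d) → ℂ)
    (hX : IsHolomorphicProcess χ ℱ P X V ext)
    -- the linear map `L : 𝒱* → 𝒮*` with `𝒜 h_u = h_{L(u)}` on `S`
    (L : VStar V →ₗ[ℝ] SStar S)
    (hL : ∀ (v : VStar V) (x : S),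
      χ.gen (ext (hV v)) x = hS (L v : Seq d) x)
    -- `X_0 = x₀`
    (x₀ : S) (hx₀ : ∀ᵐ ω ∂P, X ⊥ ω = x₀)
    (u : VStar V)
    -- (i) the sequence-valued linear ODE, componentwise and pointwise on `S`
    (c : Time T → VStar V)
    (hode : ∀ α : Fin d → ℕ,
      Integrable (fun s => (L (c s) : Seq d) α) (leb T) ∧
      ∀ t, (c t : Seq d) α =
        (u : Seq d) α +
          ∫ s in Set.Iic t, (L (c s) : Seq d) α ∂leb T)
    (hpointwise : ∀ x : S,
      Integrable (fun s => hS (L (c s) : Seq d) x) (leb T) ∧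
      ∀ t, hS (c t : Seq d) x =
        hS (u : Seq d) x +
          ∫ s in Set.Iic t, hS (L (c s) : Seq d) x ∂leb T)
    -- (ii) `N^{h_{c(s)}}` is a true martingale for each `s`
    (hmart : ∀ s, Martingale (procN χ X (ext (hV (c s)))) ℱ P)
    -- (iii) integrability of `𝒜 h_{c(s)}(X_t)` over `[0,T]²`, and at the initial sequence
    (hint : ∫⁻ t, ∫⁻ s, ∫⁻ ω, ‖χ.gen (ext (hV (c s))) (X t ω)‖ₑ ∂P ∂leb T ∂leb T < ∞)
    (hint₀ : ∫⁻ t, ∫⁻ ω, ‖χ.gen (ext (hV u)) (X t ω)‖ₑ ∂P ∂leb T < ∞) :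
    Integrable (fun ω => hS (u : Seq d) (X ⊤ ω)) P ∧
    ∫ ω, hS (u : Seq d) (X ⊤ ω) ∂P =
      hS (c ⊤ : Seq d) x₀ := by
  have hXm : Measurable (Function.uncurry X) := by
    refine Measurable.subtype_mk (measurable_uncurry_of_rightContinuous
      (Y := fun t ω => (X t ω : EuclideanSpace ℝ (Fin d))) (fun t => ?_)
      (fun ω t => (hX.jumpDiffusion.cadlag ω t).1))
    exact measurable_subtype_coe.comp ((hX.jumpDiffusion.adapted t).mono (ℱ.le t) le_rfl)
  have hc0 : c ⊥ = u := by
    refine Subtype.ext (funext fun α => ?_)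
    rw [(hode α).2 ⊥, setIntegral_Iic_leb_bot, add_zero]
  have hext : ∀ (v : VStar V) (x : S), ext (hV v) x = hS (v : Seq d) x := fun v x =>
    hX.ext_eq (hV v) x
  simp only [hL] at hint hint₀
  -- a jointly measurable version of `(s, x) ↦ 𝒜h_{c(s)}(x)`
  obtain ⟨H, hHm, hH⟩ := exists_measurable_hS (μ := leb T) S
    (v := fun s => (L (c s) : Seq d)) fun α => (hode α).1.aestronglyMeasurable
  have hHst : Measurable fun q : Time T × Time T × Ω => H q.1 (X q.2.1 q.2.2) :=
    hHm.comp (measurable_fst.prodMk (hXm.comp measurable_snd))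
  have hHts : Measurable fun q : Time T × Time T × Ω => H q.2.1 (X q.1 q.2.2) :=
    hHst.comp (by fun_prop : Measurable fun q : Time T × Time T × Ω => (q.2.1, q.1, q.2.2))
  have hHp : Measurable fun q : (Time T × Time T) × Ω => H q.1.1 (X q.1.2 q.2) :=
    hHst.comp (by fun_prop : Measurable
      fun q : (Time T × Time T) × Ω => (q.1.1, q.1.2, q.2))
  have hfin_ts : ∫⁻ t, ∫⁻ s, ∫⁻ ω, ‖H s (X t ω)‖ₑ ∂P ∂leb T ∂leb T < ∞ := by
    refine lt_of_eq_of_lt (lintegral_congr fun t => lintegral_congr_ae ?_) hint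
    filter_upwards [hH] with s hs
    rw [hs]
  have hfin_st : ∫⁻ s, ∫⁻ t, ∫⁻ ω, ‖H s (X t ω)‖ₑ ∂P ∂leb T ∂leb T < ∞ := by
    rw [lintegral_lintegral_swap]
    · exact hfin_ts
    · exact (hHp.enorm.lintegral_prod_right').aemeasurable
  -- the mixed density `ρ(s, t) = E[𝒜h_{c(s)}(X_t)]`
  set ρ : Time T → Time T → ℂ := fun s t => ∫ ω, H s (X t ω) ∂P with hρ
  have hρm : StronglyMeasurable (Function.uncurry ρ) :=
    hHp.stronglyMeasurable.integral_prod_right' (ν := P)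
  have hρi : Integrable (Function.uncurry ρ) ((leb T).prod (leb T)) := by
    have : Integrable (fun q : (Time T × Time T) × Ω => H q.1.1 (X q.1.2 q.2))
        (((leb T).prod (leb T)).prod P) := by
      refine ⟨hHp.aestronglyMeasurable, ?_⟩
      rw [HasFiniteIntegral, lintegral_prod _ hHp.enorm.aemeasurable,
        lintegral_prod _ hHp.enorm.lintegral_prod_right'.aemeasurable]
      exact hfin_st
    exact this.integral_prod_left
  have hrow : ∀ᵐ s ∂leb T, ∀ t, ∫ ω, hS (c s : Seq d) (X t ω) ∂P =
      hS (c s : Seq d) x₀ + ∫ r in Set.Iic t, ρ s r ∂leb T := by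
    filter_upwards [hH, ae_integrable_prod_of_lintegral hHst hfin_st] with s hs hsi t
    have hg : ∀ x, χ.gen (ext (hV (c s))) x = H s x := fun x => by rw [hL, hs]
    have := (integral_eq_add_integral_gen (hmart s) hx₀ (by simpa only [hg] using hsi) t).2
    simpa only [hg, hext] using this
  have hcol : ∀ᵐ t ∂leb T, ∀ s, Integrable (fun ω => hS (u : Seq d) (X t ω)) P →
      ∫ ω, hS (c s : Seq d) (X t ω) ∂P =
        ∫ ω, hS (u : Seq d) (X t ω) ∂P + ∫ r in Set.Iic s, ρ r t ∂leb T := by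
    filter_upwards [ae_integrable_prod_of_lintegral hHts hfin_ts] with t hti s hut
    obtain ⟨hI, hswap⟩ := integral_setIntegral_Iic_swap (F := fun s ω => H s (X t ω)) hti s
    have hpt : ∀ ω, hS (c s : Seq d) (X t ω) =
        hS (u : Seq d) (X t ω) + ∫ r in Set.Iic s, H r (X t ω) ∂leb T := by
      intro ω
      rw [(hpointwise (X t ω)).2 s]
      congr 1
      refine integral_congr_ae (ae_restrict_of_ae ?_)
      filter_upwards [hH] with r hr
      rw [hr]
    simp only [hpt]
    rw [integral_add hut hI, hswap]
  have hui : Integrable (fun q : Time T × Ω => hS (L u : Seq d) (X q.1 q.2))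
      ((leb T).prod P) := by
    have hm : Measurable fun q : Time T × Ω => hS (L u : Seq d) (X q.1 q.2) :=
      measurable_hS_apply (v := fun _ : Time T × Ω => (L u : Seq d)) (x := Function.uncurry X)
        (fun _ => measurable_const) hXm
    refine ⟨hm.aestronglyMeasurable, ?_⟩
    rw [HasFiniteIntegral, lintegral_prod _ hm.enorm.aemeasurable]
    exact hint₀
  have hinit : ∀ t, Integrable (fun ω => hS (u : Seq d) (X t ω)) P ∧
      ∫ ω, hS (u : Seq d) (X t ω) ∂P = hS (u : Seq d) x₀ +
        ∫ s in Set.Iic t, ∫ ω, hS (L u : Seq d) (X s ω) ∂P ∂leb T := by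
    intro t
    have := integral_eq_add_integral_gen (hc0 ▸ hmart ⊥) hx₀ (by simpa only [hL] using hui) t
    simpa only [hL, hext] using this
  refine ⟨(hinit ⊤).1, ?_⟩
  have hA : Continuous fun s => hS (c s : Seq d) x₀ := by
    simp only [(hpointwise x₀).2]
    exact continuous_const.add (continuous_setIntegral_Iic_leb (hpointwise x₀).1)
  have hB : Continuous fun t => ∫ ω, hS (u : Seq d) (X t ω) ∂P := by
    simp only [fun t => (hinit t).2]
    exact continuous_const.add (continuous_setIntegral_Iic_leb hui.integral_prod_left)
  have hT : (0 : ℝ) ≤ T := Fact.out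
  rcases hT.eq_or_lt with hT0 | hT0
  -- for `T = 0` the Lebesgue measure of `[0,T]` vanishes and the triangles carry no information
  · have htop : (⊤ : Time T) = ⊥ := Subtype.ext hT0.symm
    rw [htop, hc0, (hinit ⊥).2, setIntegral_Iic_leb_bot, add_zero]
  · have hAB := eq_of_primitives_eq hT0 hρm hρi hA hB (by
      filter_upwards [Measure.quasiMeasurePreserving_fst.ae hrow,
        Measure.quasiMeasurePreserving_snd.ae hcol] with p h1 h2
      rw [← h1 p.2, h2 p.1 (hinit p.2).1])
    exact (congrFun hAB ⊤).symm
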